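/- Let $(V,|\cdot|)$ be a real Banach space and $T>0$. Let $\omega=(\omega_{s,t})_{0\le s\le t\le T}$ be a control: $\omega_{s,t}\ge 0$, $\omega_{s,s}=0$, $\omega_{r,s}+\omega_{s,t}\le\omega_{r,t}$ for $r\le s\le t$, and $\omega$ is continuous in a neighbourhood of the diagonal. Let $\varpi:\mathbb R_+\to\mathbb R_+$ be continuous and non-decreasing with $2\varpi(x/2)\le\varkappa\,\varpi(x)$ for all $x>0$, for some $0<\varkappa<1$. Let $\delta:\mathbb R_+\to\mathbb R_+$ be non-decreasing with $\lim_{S\to0}\delta_S=0$, and let $\eta:\mathbb R_+\to\mathbb R_+$ be continuous and non-decreasing with $\eta(\omega_{s,t})\varpi(\omega_{s,t})\le\delta_T\varpi(\omega_{s,t})$ for $0\le s\le t\le T$. Let $\phi=(\phi_{t,s})_{0\le s\le t\le T}$ be a stable almost flow. That is, the maps $\phi_{t,s}:V\to V$ are continuous and, with $\phi_{t,s,r}:=\phi_{t,s}\circ\phi_{s,r}-\phi_{t,r}$, the following hold. 1. For every $t$, $\phi_{t,t}=\mathrm{id}$. For every $0<T'\le T$, all $0\le s\le t\le T'$ and all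 $a,b\in V$, $|\phi_{t,s}(a)-a|\le\delta_{T'}$ and $|\phi_{t,s}(b)-\phi_{t,s}(a)|\le(1+\delta_{T'})|b-a|+\eta(\omega_{s,t})|b-a|$. 2. There are constants $M,C\ge0$ such that for all $0\le r\le s\le t\le T$, $\sup_a|\phi_{t,s,r}(a)|\le M\varpi(\omega_{r,t})$ and $\phi_{t,s,r}$ is Lipschitz with constant $C\varpi(\omega_{r,t})$. 3. There are continuous non-decreasing functions $\widehat\phi_{t,s}:\mathbb R_+\to\mathbb R_+$ and constants $\widecheck\phi_{t,s}\ge0$, with $\widecheck\phi_{t,s}\le1+\delta_{T'}$ whenever $0\le s\le t\le T'\le T$ and $T'>0$, such that for all $a,b,c,d\in V$, $$|\phi_{t,s}(a)-\phi_{t,s}(b)-\phi_{t,s}(c)+\phi_{t,s}(d)|\le\widehat\phi_{t,s}(|a-b|\vee|c-d|)\,(|a-c|\vee|b-d|)+\widecheck\phi_{t,s}|a-b-c+d|.$$ Moreover $\widehat\phi_{t,s}\le\widehat\phi_{v,u}$ whenever $[s,t]\subset[u,v]$, and for every $\alpha\ge0$ there is $\phi^{\circledast}(\alpha)\ge0$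 with $\widehat\phi_{t,s}(\alpha\varpi(\omega_{s,t}))\le\phi^{\circledast}(\alpha)\varpi(\omega_{s,t})$ for all $s\le t$. For $r\in[0,T]$ and $a\in V$, a path $y:[r,T]\to V$ is a solution in the sense of Davie to $\dot y=\phi'(y)$ started from $a$ at time $r$ if $y_r=a$ and there is a constant $C_y$ with $|y_t-\phi_{t,s}(y_s)|\le C_y\varpi(\omega_{s,t})$ for all $r\le s\le t\le T$. A manifold of solutions is a family $(y_{r\curvearrowright\cdot}(a))_{r\in[0,T],\,a\in V}$ of such solutions, with $y_{r\curvearrowright\cdot}(a)$ started from $a$ at time $r$. Then there exists one and only one manifold of solutions to $\dot y=\phi'(y)$. It is Lipschitz in the initial condition: there is a constant $K$ such that $$\sup_{t\in[r,T]}|y_{r\curvearrowright t}(a)-y_{r\curvearrowright t}(b)|\le K|a-b|\qquad\text{for all }r\in[0,T],\ a,b\in V.$$ If moreover $\sup_{a\in V}|\phi_{t,s}(a)-a|\to0$ as $t-s\to0$, then all the paths $y_{r\curvearrowright\cdot}(a)$ are continuous, so that $a\mapsto y_{r\curvearrowright\cdot}(a)$ is Lipschitz, uniformly in $r$, from $V$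 to $\mathcal C([r,T],V)$ with the supremum norm. -/

import Mathlib

open scoped NNReal Topology

/-- `ω` is a control on `[0,T]`: super-additive, vanishing on the diagonal and continuous
close to the diagonal. Only the values `ω s t` with `s ≤ t ≤ T` matter. -/
structure IsControl (T : ℝ≥0) (ω : ℝ≥0 → ℝ≥0 → ℝ≥0) : Prop where
  superadditive : ∀ r s t, r ≤ s → s ≤ t → t ≤ T → ω r s + ω s t ≤ ω r t
  diag : ∀ s, s ≤ T → ω s s = 0
  continuous_near_diag : ∃ ε : ℝ≥0, 0 < ε ∧
    ContinuousOn (fun p : ℝ≥0 × ℝ≥0 => ω p.1 p.2)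
      {p | p.1 ≤ p.2 ∧ p.2 ≤ T ∧ p.2 ≤ p.1 + ε}

/-- `ϖ` is a remainder: continuous, increasing (in the wide sense), with
`2 ϖ(x/2) ≤ ϰ ϖ(x)` for some `0 < ϰ < 1`. -/
structure IsRemainder (ϖ : ℝ≥0 → ℝ≥0) : Prop where
  continuous : Continuous ϖ
  monotone : Monotone ϖ
  contraction : ∃ κ : ℝ≥0, 0 < κ ∧ κ < 1 ∧ ∀ x, 0 < x → 2 * ϖ (x / 2) ≤ κ * ϖ x

/-- `T ↦ δ_T` is non-decreasing and tends to `0` as `T → 0`. -/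
structure IsHorizonModulus (δ : ℝ≥0 → ℝ≥0) : Prop where
  monotone : Monotone δ
  tendsto : Filter.Tendsto δ (𝓝[>] 0) (𝓝 0)

/-- The function `η` is continuous, increasing (in the wide sense), and
`η(ω_{s,t}) ϖ(ω_{s,t})^γ ≤ δ_T ϖ(ω_{s,t})` for `0 ≤ s ≤ t ≤ T`. -/
structure IsHolderGauge (T : ℝ≥0) (ω : ℝ≥0 → ℝ≥0 → ℝ≥0) (ϖ δ : ℝ≥0 → ℝ≥0) (γ : ℝ)
    (η : ℝ≥0 → ℝ≥0) : Prop where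
  continuous : Continuous η
  monotone : Monotone η
  bound : ∀ s t, s ≤ t → t ≤ T → η (ω s t) * ϖ (ω s t) ^ γ ≤ δ T * ϖ (ω s t)

section Flows

variable {V : Type*} [NormedAddCommGroup V]

/-- The defect `φ_{t,s,r} = φ_{t,s} ∘ φ_{s,r} - φ_{t,r}`. -/
def flowDefect (φ : ℝ≥0 → ℝ≥0 → V → V) (t s r : ℝ≥0) (a : V) : V :=
  φ t s (φ s r a) - φ t r a

/-- `φ = (φ_{t,s})_{0 ≤ s ≤ t ≤ T}` (written `φ t s`) is an almost flow on the horizon `[0,T]`.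
The bounds involving `δ` hold on every smaller horizon `[0,T']`, with the constant `δ_{T'}`. -/
structure IsAlmostFlow (T : ℝ≥0) (ω : ℝ≥0 → ℝ≥0 → ℝ≥0) (ϖ δ : ℝ≥0 → ℝ≥0) (γ : ℝ)
    (η : ℝ≥0 → ℝ≥0) (φ : ℝ≥0 → ℝ≥0 → V → V) : Prop where
  continuous : ∀ s t, s ≤ t → t ≤ T → Continuous (φ t s)
  diag : ∀ t, t ≤ T → ∀ a, φ t t a = a
  near_id : ∀ T', 0 < T' → T' ≤ T → ∀ s t, s ≤ t → t ≤ T' →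
    ∀ a, ‖φ t s a - a‖ ≤ δ T'
  almost_lipschitz : ∀ T', 0 < T' → T' ≤ T → ∀ s t, s ≤ t → t ≤ T' →
    ∀ a b, ‖φ t s b - φ t s a‖ ≤ (1 + δ T') * ‖b - a‖ + η (ω s t) * ‖b - a‖ ^ γ
  almost_flow : ∃ M : ℝ≥0, ∀ r s t, r ≤ s → s ≤ t → t ≤ T →
    ∀ a, ‖flowDefect φ t s r a‖ ≤ M * ϖ (ω r t)

/-- The 4-points control of `f` with function `fhat` and constant `fcheck`. -/
structure FourPointsControl (f : V → V) (fhat : ℝ≥0 → ℝ≥0) (fcheck : ℝ≥0) : Prop where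
  monotone : Monotone fhat
  continuous : Continuous fhat
  bound : ∀ a b c d : V,
    ‖f a - f b - f c + f d‖ ≤
      fhat (max ‖a - b‖₊ ‖c - d‖₊) * max ‖a - c‖ ‖b - d‖ + fcheck * ‖a - b - c + d‖

/-- The family `φ` satisfies a `ϖ`-compatible 4-points control on `[0,T]` with functions
`hat t s` and constants `check t s`. -/
structure CompatibleFourPointsControl (T : ℝ≥0) (ω : ℝ≥0 → ℝ≥0 → ℝ≥0) (ϖ : ℝ≥0 → ℝ≥0)
    (φ : ℝ≥0 → ℝ≥0 → V → V) (hat : ℝ≥0 → ℝ≥0 → ℝ≥0 → ℝ≥0) (check : ℝ≥0 → ℝ≥0 → ℝ≥0) :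
    Prop where
  control : ∀ s t, s ≤ t → t ≤ T → FourPointsControl (φ t s) (hat t s) (check t s)
  mono_interval : ∀ u s t v, u ≤ s → s ≤ t → t ≤ v → v ≤ T → ∀ x, hat t s x ≤ hat v u x
  compatible : ∃ star : ℝ≥0 → ℝ≥0, ∀ α s t, s ≤ t → t ≤ T →
    hat t s (α * ϖ (ω s t)) ≤ star α * ϖ (ω s t)

/-- A stable almost flow on `[0,T]`: an almost flow with `γ = 1`, with a `ϖ`-compatible
4-points control whose constants are at most `1 + δ_{T'}` on each `[0,T']`, and such that the
Lipschitz seminorm of the defect `φ_{t,s,r}` is at most `C ϖ(ω_{r,t})`. -/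
structure IsStableAlmostFlow (T : ℝ≥0) (ω : ℝ≥0 → ℝ≥0 → ℝ≥0) (ϖ δ η : ℝ≥0 → ℝ≥0)
    (φ : ℝ≥0 → ℝ≥0 → V → V) : Prop where
  almostFlow : IsAlmostFlow T ω ϖ δ 1 η φ
  four_points : ∃ (hat : ℝ≥0 → ℝ≥0 → ℝ≥0 → ℝ≥0) (check : ℝ≥0 → ℝ≥0 → ℝ≥0),
    CompatibleFourPointsControl T ω ϖ φ hat check ∧
    ∀ T', 0 < T' → T' ≤ T → ∀ s t, s ≤ t → t ≤ T' → check t s ≤ 1 + δ T'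
  defect_lipschitz : ∃ C : ℝ≥0, ∀ r s t, r ≤ s → s ≤ t → t ≤ T →
    ∀ a b, ‖flowDefect φ t s r a - flowDefect φ t s r b‖ ≤ C * ϖ (ω r t) * ‖a - b‖

/-- The path `y : [r,T] → V` is a solution in the sense of Davie started from `a` at time `r`.
The constant may depend on the path. -/
def IsDavieSolution (T : ℝ≥0) (ω : ℝ≥0 → ℝ≥0 → ℝ≥0) (ϖ : ℝ≥0 → ℝ≥0)
    (φ : ℝ≥0 → ℝ≥0 → V → V) (r : Set.Icc 0 T) (a : V) (y : Set.Icc (r : ℝ≥0) T → V) : Prop :=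
  y ⟨r, le_rfl, r.2.2⟩ = a ∧
    ∃ C : ℝ≥0, ∀ s t : Set.Icc (r : ℝ≥0) T, s ≤ t →
      ‖y t - φ t s (y s)‖ ≤ C * ϖ (ω s t)

/-- A manifold of solutions: for each `r ∈ [0,T]` and `a ∈ V`, a solution
`y r a : [r,T] → V` in the sense of Davie started from `a` at time `r`. -/
def IsManifoldOfSolutions (T : ℝ≥0) (ω : ℝ≥0 → ℝ≥0 → ℝ≥0) (ϖ : ℝ≥0 → ℝ≥0)
    (φ : ℝ≥0 → ℝ≥0 → V → V) (y : (r : Set.Icc 0 T) → V → Set.Icc (r : ℝ≥0) T → V) : Prop :=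
  ∀ (r : Set.Icc 0 T) (a : V), IsDavieSolution T ω ϖ φ r a (y r a)

/-- `a ↦ y r a` is Lipschitz for the supremum norm over `[r,T]`, uniformly in `r`. -/
def IsSupLipschitz (T : ℝ≥0) (y : (r : Set.Icc 0 T) → V → Set.Icc (r : ℝ≥0) T → V) : Prop :=
  ∃ K : ℝ≥0, ∀ (r : Set.Icc 0 T) (a b : V) (t : Set.Icc (r : ℝ≥0) T), ‖y r a t - y r b t‖ ≤ K * ‖a - b‖

/-- `a ↦ y r a` takes its values in `C([r,T], V)` and is Lipschitz into that space with its
supremum norm, uniformly in `r`. -/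
def IsLipschitzIntoContinuous (T : ℝ≥0)
    (y : (r : Set.Icc 0 T) → V → Set.Icc (r : ℝ≥0) T → V) : Prop :=
  ∃ K : ℝ≥0, ∀ r : Set.Icc 0 T, ∃ Y : V → C(Set.Icc (r : ℝ≥0) T, V),
    (∀ a t, Y a t = y r a t) ∧ LipschitzWith K Y

/-- `sup_a |φ_{t,s}(a) - a|` tends to `0` as `t - s → 0`. -/
def IsTimeContinuous (T : ℝ≥0) (φ : ℝ≥0 → ℝ≥0 → V → V) : Prop :=
  ∀ ε : ℝ, 0 < ε → ∃ h : ℝ≥0, 0 < h ∧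
    ∀ s t, s ≤ t → t ≤ T → t ≤ s + h → ∀ a, ‖φ t s a - a‖ ≤ ε

end Flows

/-!
The solutions are obtained as limits of the schemes `x_t = φ_{t,s}(x_s)`, where `s < t` run through
the consecutive points of a finite set `P` of times, and everything follows from two estimates which
are uniform in `P`.

* Consistency (`IsAlmostFlow.exists_scheme_bound`): `‖x_t - φ_{t,s}(x_s)‖ ≤ α ϖ(ω_{s,t})` for all
  `s ≤ t` in `P`, not only for consecutive ones.
* Stability (`IsStableAlmostFlow.exists_scheme_lipschitz`): two schemes along `P` satisfy
  `‖x_t - y_t‖ ≤ K ‖x_s - y_s‖`.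

By a telescoping sum, a path `y` with `‖y_t - φ_{t,s}(y_s)‖ ≤ c ϖ(ω_{s,t})` is then at a distance at
most `K c ∑ ϖ(ω_{s,t})` from the scheme with the same initial value, the sum being over the steps
of `P` (`exists_scheme_close`). Since `ω` is super-additive and small on short intervals, and
`ϖ(x) = o(x)` at `0`, this bound tends to `0` as `P` increases. Applied to a finer scheme it shows
that the schemes are Cauchy along the directed set of finite sets of times; applied to a solution it
shows that the solution is the limit, hence unique. The Lipschitz bound passes to the limit.

Both estimates come from the discrete sewing lemma `exists_discrete_sewing`. For the first one it
is applied to `F_t(u) = φ_{t,u}(x_u)`, whose increments are controlled by the Lipschitz constant and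
the defect of `φ`; for the second one to `F_t(u) = φ_{t,u}(x_u) - φ_{t,u}(y_u)`, whose increments are
controlled by the 4-points inequality and the Lipschitz seminorm of the defect.

The Lipschitz constant `L` of the maps `φ_{t,s}` need not be close to `1`, since `δ_T` is arbitrary
and the bounds with a small `δ_{T'}` concern only intervals close to the time `0`. The usual proof of
the sewing lemma, which halves an interval and recurses on both parts, would need `(1 + L) κ < 2`.
Here an interval is first cut into `2 ^ k` parts, and `F_t` is telescoped over all of them with the
same `t`. A bound `B ϖ` on the parts then gives `L κ ^ k B ϖ` on the whole, with `L` to the first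
power, and it suffices to take `k` large.
-/

/-! ### Controls and remainders -/

namespace IsControl

variable {T : ℝ≥0} {ω : ℝ≥0 → ℝ≥0 → ℝ≥0}

theorem mono (hω : IsControl T ω) {u s t v : ℝ≥0} (hus : u ≤ s) (hst : s ≤ t) (htv : t ≤ v)
    (hv : v ≤ T) : ω s t ≤ ω u v :=
  calc ω s t ≤ ω u s + ω s t := le_add_self
    _ ≤ ω u t := hω.superadditive u s t hus hst (htv.trans hv)
    _ ≤ ω u t + ω t v := le_self_add
    _ ≤ ω u v := hω.superadditive u t v (hus.trans hst) htv hv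

/-- A control is small on short intervals, uniformly in their position: this is the compactness of
the diagonal of `[0,T]²`. -/
theorem exists_small (hω : IsControl T ω) {x : ℝ≥0} (hx : 0 < x) :
    ∃ h : ℝ≥0, 0 < h ∧ ∀ s t, s ≤ t → t ≤ T → t ≤ s + h → ω s t ≤ x := by
  obtain ⟨ε, hε, hc⟩ := hω.continuous_near_diag
  set S : Set (ℝ≥0 × ℝ≥0) := {p | p.1 ≤ p.2 ∧ p.2 ≤ T ∧ p.2 ≤ p.1 + ε} with hS
  have hScl : IsClosed S := by
    have h3 : IsClosed {p : ℝ≥0 × ℝ≥0 | p.2 ≤ p.1 + ε} :=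
      isClosed_le continuous_snd (continuous_fst.add continuous_const)
    exact (isClosed_le continuous_fst continuous_snd).inter
      ((isClosed_le continuous_snd continuous_const).inter h3)
  have hScpt : IsCompact S := by
    refine IsCompact.of_isClosed_subset
      ((isCompact_Icc (a := (0 : ℝ≥0)) (b := T)).prod (isCompact_Icc (a := (0 : ℝ≥0)) (b := T)))
      hScl ?_
    rintro ⟨s, t⟩ ⟨h1, h2, -⟩
    exact ⟨⟨zero_le, h1.trans h2⟩, ⟨zero_le, h2⟩⟩
  have hu := hScpt.uniformContinuousOn_of_continuous hc
  rw [Metric.uniformContinuousOn_iff] at hu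
  obtain ⟨d, hd, H⟩ := hu x (by exact_mod_cast hx)
  refine ⟨min ε ⟨d / 2, by positivity⟩, lt_min hε (by exact_mod_cast half_pos hd), ?_⟩
  intro s t hst ht hth
  have h1 : t ≤ s + ε := hth.trans (add_le_add_right (min_le_left _ _) s)
  have h2 : (t : ℝ) ≤ s + d / 2 := by
    have : t ≤ s + ⟨d / 2, by positivity⟩ := hth.trans (add_le_add_right (min_le_right _ _) s)
    exact_mod_cast this
  have hst' : (s : ℝ) ≤ t := by exact_mod_cast hst
  have := H (s, t) ⟨hst, ht, h1⟩ (s, s) ⟨le_rfl, hst.trans ht, le_self_add⟩ (by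
    rw [Prod.dist_eq, max_lt_iff]
    refine ⟨by simpa using hd, ?_⟩
    rw [NNReal.dist_eq, abs_lt]
    constructor <;> simp only <;> linarith)
  simp only [hω.diag s (hst.trans ht), NNReal.dist_eq, NNReal.coe_zero, sub_zero,
    NNReal.abs_eq] at this
  exact_mod_cast this.le

/-- There is a finite grid such that `ω` is small on every interval with no grid point inside. -/
theorem exists_grid (hω : IsControl T ω) {x : ℝ≥0} (hx : 0 < x) :
    ∃ G : Finset ℝ≥0, ∀ s t, s ≤ t → t ≤ T → (∀ g ∈ G, g ≤ s ∨ t ≤ g) → ω s t ≤ x := by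
  obtain ⟨h, hh, H⟩ := hω.exists_small hx
  obtain ⟨N, hN⟩ := exists_nat_gt (T / (h / 2))
  have hh2 : 0 < h / 2 := half_pos hh
  refine ⟨(Finset.range (N + 1)).image fun i : ℕ => (i : ℝ≥0) * (h / 2), ?_⟩
  intro s t hst ht hG
  refine H s t hst ht ?_
  by_contra! hlt
  -- the first multiple of `h / 2` after `s` lies strictly between `s` and `t`
  set n : ℕ := ⌊s / (h / 2)⌋₊ with hn
  have h1 : (n : ℝ≥0) * (h / 2) ≤ s := by
    rw [← le_div_iff₀ hh2]; exact Nat.floor_le zero_le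
  have h2 : s < (n + 1 : ℕ) * (h / 2) := by
    rw [← div_lt_iff₀ hh2]; exact_mod_cast Nat.lt_floor_add_one _
  have h3 : ((n + 1 : ℕ) : ℝ≥0) * (h / 2) < t := by
    refine lt_of_le_of_lt ?_ hlt
    push_cast
    rw [add_mul, one_mul]
    exact add_le_add h1 (half_le_self zero_le)
  have h4 : n + 1 < N + 1 := by
    have : ((n + 1 : ℕ) : ℝ≥0) < N := by
      refine lt_trans ?_ hN
      rw [lt_div_iff₀ hh2]
      exact h3.trans_le ht
    have : n + 1 < N := by exact_mod_cast this
    omega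
  rcases hG _ (Finset.mem_image_of_mem _ (Finset.mem_range.2 h4)) with h5 | h5
  · exact absurd h5 (not_le.2 h2)
  · exact absurd h5 (not_le.2 h3)

end IsControl

namespace IsRemainder

variable {ϖ : ℝ≥0 → ℝ≥0}

theorem map_zero (hϖ : IsRemainder ϖ) : ϖ 0 = 0 := by
  obtain ⟨κ, -, hκ1, hκ⟩ := hϖ.contraction
  have hcl : IsClosed {x : ℝ≥0 | 2 * ϖ (x / 2) ≤ κ * ϖ x} := by
    refine isClosed_le ?_ ?_
    · exact continuous_const.mul (hϖ.continuous.comp (continuous_id.div_const 2))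
    · exact continuous_const.mul hϖ.continuous
  have h0 : (0 : ℝ≥0) ∈ closure (Set.Ioi (0 : ℝ≥0)) := by
    rw [closure_Ioi]; exact Set.self_mem_Ici
  have h1 : 2 * ϖ (0 / 2) ≤ κ * ϖ 0 := hcl.closure_subset_iff.2 (fun x hx => hκ x hx) h0
  rw [zero_div] at h1
  by_contra hne
  have hpos : 0 < ϖ 0 := pos_iff_ne_zero.2 hne
  have : κ * ϖ 0 < 2 * ϖ 0 := by
    gcongr
    exact hκ1.trans (by norm_num)
  exact absurd h1 (not_le.2 this)

/-- The contraction inequality of a remainder, iterated `k` times. -/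
theorem exists_pow_contraction (hϖ : IsRemainder ϖ) :
    ∃ κ : ℝ, 0 < κ ∧ κ < 1 ∧ ∀ (k : ℕ) (x : ℝ≥0), 2 ^ k * (ϖ (x / 2 ^ k) : ℝ) ≤ κ ^ k * ϖ x := by
  obtain ⟨κ, hκ0, hκ1, hκ⟩ := hϖ.contraction
  have hκ' : ∀ x, 2 * (ϖ (x / 2) : ℝ) ≤ κ * ϖ x := by
    intro x
    rcases eq_or_ne x 0 with rfl | hx
    · simp [hϖ.map_zero]
    · exact_mod_cast hκ x (pos_iff_ne_zero.2 hx)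
  refine ⟨κ, by exact_mod_cast hκ0, by exact_mod_cast hκ1, fun k => ?_⟩
  induction k with
  | zero => intro x; simp
  | succ k ih =>
    intro x
    have h1 := ih (x / 2)
    rw [div_div, ← pow_succ'] at h1
    calc (2 : ℝ) ^ (k + 1) * ϖ (x / 2 ^ (k + 1))
        = 2 * (2 ^ k * ϖ (x / 2 ^ (k + 1))) := by ring
      _ ≤ 2 * (κ ^ k * ϖ (x / 2)) := by gcongr
      _ = κ ^ k * (2 * ϖ (x / 2)) := by ring
      _ ≤ κ ^ k * (κ * ϖ x) := mul_le_mul_of_nonneg_left (hκ' x) (by positivity)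
      _ = κ ^ (k + 1) * ϖ x := by ring

/-- A remainder is negligible with respect to the identity at `0`. -/
theorem exists_le_mul (hϖ : IsRemainder ϖ) {ε : ℝ} (hε : 0 < ε) :
    ∃ x₀ : ℝ≥0, 0 < x₀ ∧ ∀ x ≤ x₀, (ϖ x : ℝ) ≤ ε * x := by
  obtain ⟨κ, hκ0, hκ1, hκ⟩ := hϖ.exists_pow_contraction
  obtain ⟨N, hN⟩ : ∃ N : ℕ, κ ^ N < ε / (2 * (ϖ 1 + 1)) :=
    exists_pow_lt_of_lt_one (by positivity) hκ1
  rw [lt_div_iff₀ (by positivity)] at hN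
  refine ⟨(1 / 2) ^ N, by positivity, fun x hx => ?_⟩
  rcases eq_or_ne x 0 with rfl | hx0
  · simp [hϖ.map_zero]
  have hxpos : 0 < x := pos_iff_ne_zero.2 hx0
  obtain ⟨n, hn1, hn2⟩ := exists_nat_pow_near_of_lt_one hxpos
    (hx.trans (pow_le_one₀ zero_le (by norm_num))) (y := 1 / 2) (by norm_num)
    (half_lt_self one_pos)
  have hNn : N ≤ n := by
    by_contra! hlt
    have : (1 / 2 : ℝ≥0) ^ N ≤ (1 / 2) ^ (n + 1) :=
      pow_le_pow_of_le_one zero_le (by norm_num) hlt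
    exact absurd (hx.trans this) (not_le.2 hn1)
  have h1 := hκ n 1
  have h2 : (ϖ x : ℝ) ≤ ϖ (1 / 2 ^ n) := by
    have := hϖ.monotone hn2
    rw [one_div_pow] at this
    exact_mod_cast this
  have h3 : (1 : ℝ) ≤ 2 * (2 ^ n * x) := by
    have h4 : ((1 / 2 : ℝ≥0) ^ (n + 1) : ℝ≥0) ≤ x := hn1.le
    have h5 : (1 / 2 : ℝ) ^ (n + 1) ≤ x := by exact_mod_cast h4
    calc (1 : ℝ) = 2 ^ (n + 1) * (1 / 2) ^ (n + 1) := by rw [← mul_pow]; norm_num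
      _ ≤ 2 ^ (n + 1) * x := by gcongr
      _ = _ := by ring
  calc (ϖ x : ℝ) ≤ ϖ (1 / 2 ^ n) := h2
    _ = ϖ (1 / 2 ^ n) * 1 := (mul_one _).symm
    _ ≤ ϖ (1 / 2 ^ n) * (2 * (2 ^ n * x)) := by gcongr
    _ = 2 * x * (2 ^ n * ϖ (1 / 2 ^ n)) := by ring
    _ ≤ 2 * x * (κ ^ n * ϖ 1) := by gcongr
    _ ≤ 2 * x * (κ ^ N * (ϖ 1 + 1)) := by
      refine mul_le_mul_of_nonneg_left ?_ (by positivity)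
      exact mul_le_mul (pow_le_pow_of_le_one hκ0.le hκ1.le hNn) (by linarith) (by positivity)
        (by positivity)
    _ = (κ ^ N * (2 * (ϖ 1 + 1))) * x := by ring
    _ ≤ ε * x := by gcongr

end IsRemainder

/-! ### Sewing along a finite set of times -/

/-- `s < t` are consecutive points of the finite set of times `P`. -/
def ConsecutiveIn (P : Finset ℝ≥0) (s t : ℝ≥0) : Prop :=
  s ∈ P ∧ t ∈ P ∧ s < t ∧ ∀ u ∈ P, u ≤ s ∨ t ≤ u

theorem exists_consecutiveIn {P : Finset ℝ≥0} {s t : ℝ≥0} (hs : s ∈ P) (ht : t ∈ P) (hst : s < t) :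
    ∃ q, ConsecutiveIn P s q ∧ q ≤ t := by
  obtain ⟨q, hq, hmin⟩ := (P.filter (s < ·)).exists_min_image id
    ⟨t, Finset.mem_filter.2 ⟨ht, hst⟩⟩
  rw [Finset.mem_filter] at hq
  refine ⟨q, ⟨hs, hq.1, hq.2, fun u hu => ?_⟩, hmin t (Finset.mem_filter.2 ⟨ht, hst⟩)⟩
  rcases le_or_gt u s with h | h
  · exact Or.inl h
  · exact Or.inr (hmin u (Finset.mem_filter.2 ⟨hu, h⟩))

theorem ConsecutiveIn.of_filter {P : Finset ℝ≥0} {a b s t : ℝ≥0}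
    (h : ConsecutiveIn (P.filter fun u => a ≤ u ∧ u ≤ b) s t) : ConsecutiveIn P s t := by
  obtain ⟨hs, ht, hst, H⟩ := h
  rw [Finset.mem_filter] at hs ht
  refine ⟨hs.1, ht.1, hst, fun u hu => ?_⟩
  by_cases hu' : a ≤ u ∧ u ≤ b
  · exact H u (Finset.mem_filter.2 ⟨hu, hu'⟩)
  · rw [not_and_or, not_le, not_le] at hu'
    rcases hu' with h | h
    · exact Or.inl (h.le.trans hs.2.1)
    · exact Or.inr (ht.2.2.trans h.le)

/-- Halving a discrete interval: a single step `p, q` separates two parts on each of which the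
control is at most half of its value on the whole interval. -/
theorem IsControl.exists_halving {T : ℝ≥0} {ω : ℝ≥0 → ℝ≥0 → ℝ≥0} (hω : IsControl T ω)
    {P : Finset ℝ≥0} (hP : ∀ u ∈ P, u ≤ T) {u v : ℝ≥0} (hu : u ∈ P) (hv : v ∈ P) (huv : u < v) :
    ∃ p q, ConsecutiveIn P p q ∧ u ≤ p ∧ q ≤ v ∧ ω u p ≤ ω u v / 2 ∧ ω q v ≤ ω u v / 2 := by
  obtain ⟨p, hp, hmax⟩ := (P.filter fun p => u ≤ p ∧ p < v ∧ ω u p ≤ ω u v / 2).exists_max_image id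
    ⟨u, Finset.mem_filter.2 ⟨hu, le_rfl, huv, by simp [hω.diag u (hP u hu)]⟩⟩
  simp only [Finset.mem_filter, id] at hp hmax
  obtain ⟨hpP, hup, hpv, hωp⟩ := hp
  obtain ⟨q, hq, hqv⟩ := exists_consecutiveIn hpP hv hpv
  refine ⟨p, q, hq, hup, hqv, hωp, ?_⟩
  rcases hqv.eq_or_lt with rfl | hlt
  · simp [hω.diag q (hP q hv)]
  · have huq : u ≤ q := hup.trans hq.2.2.1.le
    have h1 : ω u v / 2 < ω u q := by
      by_contra! hle
      exact absurd (hmax q ⟨hq.2.1, huq, hlt, hle⟩) (not_le.2 hq.2.2.1)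
    have h2 := hω.superadditive u q v huq hqv (hP v hv)
    rw [← NNReal.coe_le_coe] at h2 ⊢
    rw [← NNReal.coe_lt_coe] at h1
    push_cast at h1 h2 ⊢
    linarith

section Sewing

variable {W : Type*} [NormedAddCommGroup W] {T : ℝ≥0} {ω : ℝ≥0 → ℝ≥0 → ℝ≥0} {ϖ : ℝ≥0 → ℝ≥0}

/-- Telescoping `F t` along `k` successive halvings of `[u,v]`. The Lipschitz constant `L` enters
once, whatever the number `2 ^ k` of pieces. -/
theorem norm_sub_le_of_halvings (hω : IsControl T ω) (hϖ : IsRemainder ϖ) {P : Finset ℝ≥0}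
    (hP : ∀ u ∈ P, u ≤ T) {F : ℝ≥0 → ℝ≥0 → W} {L D B : ℝ} (hL : 0 ≤ L) (hD : 0 ≤ D) (hB : 0 ≤ B)
    (hstep : ∀ u ∈ P, ∀ v ∈ P, ∀ t ∈ P, u ≤ v → v ≤ t →
      ‖F t v - F t u‖ ≤ L * ‖F v v - F v u‖ + D * ϖ (ω u t))
    (hjump : ∀ s t, ConsecutiveIn P s t → F t t = F t s) {t : ℝ≥0} (ht : t ∈ P) (k : ℕ) :
    ∀ u ∈ P, ∀ v ∈ P, u ≤ v → v ≤ t →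
      (∀ u' ∈ P, ∀ v' ∈ P, u ≤ u' → u' ≤ v' → v' ≤ v →
        ‖F v' v' - F v' u'‖ ≤ B * ϖ (ω u' v')) →
      ‖F t v - F t u‖ ≤ L * B * (2 ^ k * ϖ (ω u v / 2 ^ k)) + (2 ^ (k + 1) - 1) * D * ϖ (ω u t) := by
  induction k with
  | zero =>
    intro u hu v hv huv hvt hIH
    have h1 := hstep u hu v hv t ht huv hvt
    have h2 := mul_le_mul_of_nonneg_left (hIH u hu v hv le_rfl huv le_rfl) hL
    simp only [pow_zero, div_one, one_mul, zero_add, pow_one]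
    linarith
  | succ k ih =>
    intro u hu v hv huv hvt hIH
    have hk : (1 : ℝ) ≤ 2 ^ (k + 1) := one_le_pow₀ (by norm_num)
    have hk2 : (2 : ℝ) ^ (k + 1 + 1) = 2 * 2 ^ (k + 1) := by ring
    rcases huv.eq_or_lt with rfl | hlt
    · rw [sub_self, norm_zero]
      have : (0 : ℝ) ≤ 2 ^ (k + 1 + 1) - 1 := by linarith
      positivity
    obtain ⟨p, q, hpq, hup, hqv, hωp, hωq⟩ := hω.exists_halving hP hu hv hlt
    have hpv : p ≤ v := hpq.2.2.1.le.trans hqv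
    have huq : u ≤ q := hup.trans hpq.2.2.1.le
    have hmon : ∀ w, u ≤ w → w ≤ t → (ϖ (ω w t) : ℝ) ≤ ϖ (ω u t) := fun w hw hwt => by
      exact_mod_cast hϖ.monotone (hω.mono hw hwt le_rfl (hP t ht))
    have hhalf : ∀ y, y ≤ ω u v / 2 → (ϖ (y / 2 ^ k) : ℝ) ≤ ϖ (ω u v / 2 ^ (k + 1)) := by
      intro y hy
      rw [pow_succ', ← div_div]
      exact_mod_cast hϖ.monotone (by gcongr)
    have h1 := ih u hu p hpq.1 hup (hpv.trans hvt)
      fun u' hu' v' hv' h1 h2 h3 => hIH u' hu' v' hv' h1 h2 (h3.trans hpv)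
    have h2 := ih q hpq.2.1 v hv hqv hvt
      fun u' hu' v' hv' h1 h2 h3 => hIH u' hu' v' hv' (huq.trans h1) h2 h3
    have h3 := hstep p hpq.1 q hpq.2.1 t ht hpq.2.2.1.le (hqv.trans hvt)
    rw [hjump p q hpq, sub_self, norm_zero, mul_zero, zero_add] at h3
    have hk1 : (0 : ℝ) ≤ 2 ^ (k + 1) - 1 := by linarith
    have h1' : ‖F t p - F t u‖ ≤ L * B * (2 ^ k * ϖ (ω u v / 2 ^ (k + 1)))
        + (2 ^ (k + 1) - 1) * D * ϖ (ω u t) := by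
      refine h1.trans ?_
      gcongr
      exact hhalf _ hωp
    have h2' : ‖F t v - F t q‖ ≤ L * B * (2 ^ k * ϖ (ω u v / 2 ^ (k + 1)))
        + (2 ^ (k + 1) - 1) * D * ϖ (ω u t) := by
      refine h2.trans ?_
      gcongr
      · exact hhalf _ hωq
      · exact hmon q huq (hqv.trans hvt)
    have h3' : ‖F t q - F t p‖ ≤ D * ϖ (ω u t) := by
      refine h3.trans ?_
      gcongr
      exact hmon p hup (hpv.trans hvt)
    calc ‖F t v - F t u‖ = ‖(F t v - F t q) + (F t q - F t p) + (F t p - F t u)‖ := by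
          congr 1; abel
      _ ≤ ‖F t v - F t q‖ + ‖F t q - F t p‖ + ‖F t p - F t u‖ := norm_add₃_le
      _ ≤ (L * B * (2 ^ k * ϖ (ω u v / 2 ^ (k + 1))) + (2 ^ (k + 1) - 1) * D * ϖ (ω u t))
          + D * ϖ (ω u t)
          + (L * B * (2 ^ k * ϖ (ω u v / 2 ^ (k + 1))) + (2 ^ (k + 1) - 1) * D * ϖ (ω u t)) := by
        gcongr
      _ = _ := by ring

/-- Discrete sewing lemma. Think of `F t u` as the effect at time `t` of the state at time `u`
transported by one application of the approximate flow: if `F` does not see the single steps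
of `P`, then `F t t - F t s` is of the order of the remainder, with a constant which depends neither
on `P` nor on `F`. -/
theorem exists_discrete_sewing (hω : IsControl T ω) (hϖ : IsRemainder ϖ) {L : ℝ} (hL : 0 ≤ L) :
    ∃ A : ℝ, 0 ≤ A ∧ ∀ (P : Finset ℝ≥0), (∀ u ∈ P, u ≤ T) → ∀ (F : ℝ≥0 → ℝ≥0 → W) (D : ℝ), 0 ≤ D →
      (∀ u ∈ P, ∀ v ∈ P, ∀ t ∈ P, u ≤ v → v ≤ t →
        ‖F t v - F t u‖ ≤ L * ‖F v v - F v u‖ + D * ϖ (ω u t)) →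
      (∀ s t, ConsecutiveIn P s t → F t t = F t s) →
      ∀ s ∈ P, ∀ t ∈ P, s ≤ t → ‖F t t - F t s‖ ≤ A * D * ϖ (ω s t) := by
  obtain ⟨κ, hκ0, hκ1, hκ⟩ := hϖ.exists_pow_contraction
  -- the number of halvings is such that the gain `κ ^ k` absorbs the single factor `L`
  obtain ⟨k, hk⟩ : ∃ k : ℕ, κ ^ k < 1 / (4 * (L + 1)) :=
    exists_pow_lt_of_lt_one (by positivity) hκ1
  rw [lt_div_iff₀ (by positivity)] at hk
  have hκk : 0 < κ ^ k := pow_pos hκ0 k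
  refine ⟨2 ^ (k + 3), by positivity, fun P hP F D hD hstep hjump => ?_⟩
  have key : ∀ n : ℕ, ∀ s ∈ P, ∀ t ∈ P, s ≤ t → (P.filter fun u => s ≤ u ∧ u ≤ t).card ≤ n →
      ‖F t t - F t s‖ ≤ 2 ^ (k + 3) * D * ϖ (ω s t) := by
    intro n
    induction n with
    | zero =>
      intro s hs t ht hst hcard
      have : s ∈ P.filter fun u => s ≤ u ∧ u ≤ t := Finset.mem_filter.2 ⟨hs, le_rfl, hst⟩
      rw [Nat.le_zero, Finset.card_eq_zero] at hcard
      simp [hcard] at this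
    | succ n ih =>
      intro s hs t ht hst hcard
      rcases hst.eq_or_lt with rfl | hlt
      · rw [sub_self, norm_zero]; positivity
      obtain ⟨p, q, hpq, hsp, hqt, hωp, hωq⟩ := hω.exists_halving hP hs ht hlt
      have hpt : p < t := hpq.2.2.1.trans_le hqt
      have hsq : s < q := hsp.trans_lt hpq.2.2.1
      -- the bound is already known on the intervals which miss an end point of `[s,t]`
      have hsub : ∀ u' ∈ P, ∀ v' ∈ P, s ≤ u' → u' ≤ v' → v' ≤ t → (s < u' ∨ v' < t) →
          ‖F v' v' - F v' u'‖ ≤ 2 ^ (k + 3) * D * ϖ (ω u' v') := by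
        intro u' hu' v' hv' h1 h2 h3 h4
        refine ih u' hu' v' hv' h2 (Nat.lt_succ_iff.1 (lt_of_lt_of_le ?_ hcard))
        refine Finset.card_lt_card (Finset.ssubset_iff_subset_ne.2 ⟨fun w hw => ?_, fun heq => ?_⟩)
        · rw [Finset.mem_filter] at hw ⊢
          exact ⟨hw.1, h1.trans hw.2.1, hw.2.2.trans h3⟩
        · have hs' : s ∈ P.filter fun u => u' ≤ u ∧ u ≤ v' :=
            heq ▸ Finset.mem_filter.2 ⟨hs, le_rfl, hst⟩
          have ht' : t ∈ P.filter fun u => u' ≤ u ∧ u ≤ v' :=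
            heq ▸ Finset.mem_filter.2 ⟨ht, hst, le_rfl⟩
          rw [Finset.mem_filter] at hs' ht'
          rcases h4 with h4 | h4
          · exact absurd hs'.2.1 (not_le.2 h4)
          · exact absurd ht'.2.2 (not_le.2 h4)
      have hB : (0 : ℝ) ≤ 2 ^ (k + 3) * D := by positivity
      have h1 := norm_sub_le_of_halvings hω hϖ hP hL hD hB hstep hjump ht k s hs p hpq.1 hsp hpt.le
        fun u' hu' v' hv' h1 h2 h3 =>
          hsub u' hu' v' hv' h1 h2 (h3.trans hpt.le) (Or.inr (h3.trans_lt hpt))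
      have h2 := norm_sub_le_of_halvings hω hϖ hP hL hD hB hstep hjump ht k q hpq.2.1 t ht hqt le_rfl
        fun u' hu' v' hv' h1 h2 h3 =>
          hsub u' hu' v' hv' (hsq.le.trans h1) h2 h3 (Or.inl (hsq.trans_le h1))
      have h3 := hstep p hpq.1 q hpq.2.1 t ht hpq.2.2.1.le hqt
      rw [hjump p q hpq, sub_self, norm_zero, mul_zero, zero_add] at h3
      have hmon : ∀ w, s ≤ w → w ≤ t → (ϖ (ω w t) : ℝ) ≤ ϖ (ω s t) := fun w hw hwt => by
        exact_mod_cast hϖ.monotone (hω.mono hw hwt le_rfl (hP t ht))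
      have hhalf : ∀ y, y ≤ ω s t / 2 → 2 ^ k * (ϖ (y / 2 ^ k) : ℝ) ≤ κ ^ k * ϖ (ω s t) := by
        intro y hy
        refine (hκ k y).trans ?_
        gcongr
        exact_mod_cast hϖ.monotone (hy.trans (half_le_self zero_le))
      have hk1 : (0 : ℝ) ≤ 2 ^ (k + 1) - 1 := by
        have : (1 : ℝ) ≤ 2 ^ (k + 1) := one_le_pow₀ (by norm_num)
        linarith
      have hκL : 4 * (L * κ ^ k) ≤ 1 := by linarith
      have h1' : ‖F t p - F t s‖ ≤ L * (2 ^ (k + 3) * D) * (κ ^ k * ϖ (ω s t))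
          + (2 ^ (k + 1) - 1) * D * ϖ (ω s t) := by
        refine h1.trans ?_
        gcongr L * (2 ^ (k + 3) * D) * ?_ + _
        exact hhalf _ hωp
      have h2' : ‖F t t - F t q‖ ≤ L * (2 ^ (k + 3) * D) * (κ ^ k * ϖ (ω s t))
          + (2 ^ (k + 1) - 1) * D * ϖ (ω s t) := by
        refine h2.trans ?_
        gcongr L * (2 ^ (k + 3) * D) * ?_ + _ * ?_
        · exact hhalf _ hωq
        · exact hmon q hsq.le hqt
      have h3' : ‖F t q - F t p‖ ≤ D * ϖ (ω s t) :=
        h3.trans (mul_le_mul_of_nonneg_left (hmon p hsp hpt.le) hD)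
      have hDϖ : 0 ≤ D * ϖ (ω s t) := by positivity
      calc ‖F t t - F t s‖ = ‖(F t t - F t q) + (F t q - F t p) + (F t p - F t s)‖ := by
            congr 1; abel
        _ ≤ ‖F t t - F t q‖ + ‖F t q - F t p‖ + ‖F t p - F t s‖ := norm_add₃_le
        _ ≤ 4 * (L * κ ^ k) * (2 ^ (k + 2) * (D * ϖ (ω s t)))
            + (2 ^ (k + 2) - 1) * (D * ϖ (ω s t)) := by
          refine (add_le_add (add_le_add h2' h3') h1').trans (le_of_eq (by ring))
        _ ≤ 1 * (2 ^ (k + 2) * (D * ϖ (ω s t))) + 2 ^ (k + 2) * (D * ϖ (ω s t)) := by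
          gcongr
          linarith
        _ = 2 ^ (k + 3) * D * ϖ (ω s t) := by ring
  exact fun s hs t ht hst => key _ s hs t ht hst le_rfl

end Sewing

/-! ### Discrete schemes -/

section Schemes

variable {V : Type*} {φ : ℝ≥0 → ℝ≥0 → V → V}

/-- `x` is obtained by iterating `φ` along the finite set of times `P`. Only the values of `x`
at the points of `P` matter. -/
def IsScheme (φ : ℝ≥0 → ℝ≥0 → V → V) (P : Finset ℝ≥0) (x : ℝ≥0 → V) : Prop :=
  ∀ s t, ConsecutiveIn P s t → x t = φ t s (x s)

theorem IsScheme.filter {P : Finset ℝ≥0} {x : ℝ≥0 → V} (hx : IsScheme φ P x) (a b : ℝ≥0) :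
    IsScheme φ (P.filter fun u => a ≤ u ∧ u ≤ b) x :=
  fun s t h => hx s t h.of_filter

theorem exists_isScheme (φ : ℝ≥0 → ℝ≥0 → V → V) (r : ℝ≥0) (a : V) (P : Finset ℝ≥0) :
    (∀ u ∈ P, r ≤ u) → ∃ x : ℝ≥0 → V, IsScheme φ P x ∧ x r = a := by
  induction P using Finset.induction_on_max with
  | empty => exact fun _ => ⟨fun _ => a, fun s t h => absurd h.1 (Finset.notMem_empty s), rfl⟩
  | insert m P hm ih =>
    intro hP
    obtain ⟨x, hx, hxr⟩ := ih fun u hu => hP u (Finset.mem_insert_of_mem hu)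
    have hmP : m ∉ P := fun h => lt_irrefl m (hm m h)
    rcases P.eq_empty_or_nonempty with rfl | hne
    · refine ⟨x, fun s t h => ?_, hxr⟩
      obtain ⟨hs, ht, hst, -⟩ := h
      simp only [insert_empty_eq, Finset.mem_singleton] at hs ht
      exact absurd hst (by rw [hs, ht]; exact lt_irrefl m)
    · set q := P.max' hne with hq
      have hqP : q ∈ P := P.max'_mem hne
      have hrm : r ≠ m := ((hP q (Finset.mem_insert_of_mem hqP)).trans_lt (hm q hqP)).ne
      refine ⟨Function.update x m (φ m q (x q)), fun s t h => ?_, ?_⟩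
      · obtain ⟨hs, ht, hst, H⟩ := h
        have hsP : s ∈ P := by
          rcases Finset.mem_insert.1 hs with rfl | h
          · rcases Finset.mem_insert.1 ht with rfl | h'
            · exact absurd hst (lt_irrefl _)
            · exact absurd hst (hm t h').not_gt
          · exact h
        rw [Function.update_of_ne (ne_of_mem_of_not_mem hsP hmP) _ x]
        rcases Finset.mem_insert.1 ht with rfl | htP
        · have hsq : s = q := by
            rcases H q (Finset.mem_insert_of_mem hqP) with h | h
            · exact le_antisymm (P.le_max' s hsP) h
            · exact absurd h (not_le.2 (hm q hqP))
          rw [Function.update_self, hsq]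
        · rw [Function.update_of_ne (ne_of_mem_of_not_mem htP hmP) _ x]
          exact hx s t ⟨hsP, htP, hst, fun u hu => H u (Finset.mem_insert_of_mem hu)⟩
      · rwa [Function.update_of_ne hrm]

variable [NormedAddCommGroup V] {T : ℝ≥0} {ω : ℝ≥0 → ℝ≥0 → ℝ≥0} {ϖ δ η : ℝ≥0 → ℝ≥0}

/-- All the maps of an almost flow with `γ = 1` share a Lipschitz constant. -/
theorem IsAlmostFlow.exists_lipschitz (hT : 0 < T) (hω : IsControl T ω)
    (hη : Monotone η) (hφ : IsAlmostFlow T ω ϖ δ 1 η φ) :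
    ∃ L : ℝ, 1 ≤ L ∧ ∀ s t, s ≤ t → t ≤ T → ∀ a b, ‖φ t s a - φ t s b‖ ≤ L * ‖a - b‖ := by
  refine ⟨1 + δ T + η (ω 0 T), ?_, fun s t hst ht a b => ?_⟩
  · have h1 := (δ T).coe_nonneg
    have h2 := (η (ω 0 T)).coe_nonneg
    linarith
  · refine (hφ.almost_lipschitz T hT le_rfl s t hst ht b a).trans ?_
    rw [Real.rpow_one, ← add_mul]
    gcongr
    exact hη (hω.mono zero_le hst ht le_rfl)

/-- Along a scheme, any number of steps is comparable to a single step, up to the remainder. -/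
theorem IsAlmostFlow.exists_scheme_bound (hω : IsControl T ω) (hϖ : IsRemainder ϖ)
    (hφ : IsAlmostFlow T ω ϖ δ 1 η φ) {L : ℝ} (hL : 0 ≤ L)
    (hφL : ∀ s t, s ≤ t → t ≤ T → ∀ a b, ‖φ t s a - φ t s b‖ ≤ L * ‖a - b‖) :
    ∃ α : ℝ≥0, ∀ P : Finset ℝ≥0, (∀ u ∈ P, u ≤ T) → ∀ x, IsScheme φ P x →
      ∀ s ∈ P, ∀ t ∈ P, s ≤ t → ‖x t - φ t s (x s)‖ ≤ α * ϖ (ω s t) := by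
  obtain ⟨M, hM⟩ := hφ.almost_flow
  obtain ⟨A, hA, HA⟩ := exists_discrete_sewing (W := V) hω hϖ hL
  lift A to ℝ≥0 using hA
  refine ⟨A * M, fun P hP x hx s hs t ht hst => ?_⟩
  have key := HA P hP (fun t u => φ t u (x u)) M M.coe_nonneg ?_ ?_ s hs t ht hst
  · simpa only [hφ.diag t (hP t ht), NNReal.coe_mul] using key
  · intro u hu v hv t ht huv hvt
    rw [hφ.diag v (hP v hv)]
    calc ‖φ t v (x v) - φ t u (x u)‖
        = ‖(φ t v (x v) - φ t v (φ v u (x u))) + flowDefect φ t v u (x u)‖ := by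
          rw [flowDefect]; congr 1; abel
      _ ≤ ‖φ t v (x v) - φ t v (φ v u (x u))‖ + ‖flowDefect φ t v u (x u)‖ := norm_add_le _ _
      _ ≤ _ := add_le_add (hφL v t hvt (hP t ht) _ _) (hM u v t huv hvt (hP t ht) _)
  · intro s t hst
    rw [hφ.diag t (hP t hst.2.1), hx s t hst]

/-- Two schemes on a common set of times: up to an error of the order of the remainder, their
difference is transported by a single step of `φ`. The error is relative to a bound `S` on
the difference; this is where the 4-points control enters. -/
theorem IsStableAlmostFlow.exists_scheme_sub_bound (hT : 0 < T) (hω : IsControl T ω)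
    (hϖ : IsRemainder ϖ) (hφ : IsStableAlmostFlow T ω ϖ δ η φ) {L : ℝ} (hL : 1 ≤ L)
    (hφL : ∀ s t, s ≤ t → t ≤ T → ∀ a b, ‖φ t s a - φ t s b‖ ≤ L * ‖a - b‖) :
    ∃ B : ℝ, 0 ≤ B ∧ ∀ P : Finset ℝ≥0, (∀ u ∈ P, u ≤ T) → ∀ x y, IsScheme φ P x → IsScheme φ P y →
      ∀ S : ℝ, (∀ u ∈ P, ‖x u - y u‖ ≤ S) →
      ∀ s ∈ P, ∀ t ∈ P, s ≤ t →
        ‖(x t - y t) - (φ t s (x s) - φ t s (y s))‖ ≤ B * S * ϖ (ω s t) := by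
  have hL0 : 0 ≤ L := zero_le_one.trans hL
  obtain ⟨α, hα⟩ := hφ.almostFlow.exists_scheme_bound hω hϖ hL0 hφL
  obtain ⟨hat, check, h4, hcheck⟩ := hφ.four_points
  obtain ⟨star, hstar⟩ := h4.compatible
  obtain ⟨C, hC⟩ := hφ.defect_lipschitz
  -- a Lipschitz constant which also dominates the constants of the 4-points control
  set L' : ℝ := max L (1 + δ T) with hL'
  have hL'0 : 0 ≤ L' := hL0.trans (le_max_left _ _)
  obtain ⟨A, hA, HA⟩ := exists_discrete_sewing (W := V) hω hϖ hL'0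
  refine ⟨A * (star α * L + C), by positivity, fun P hP x y hx hy S hS s hs t ht hst => ?_⟩
  have hS0 : 0 ≤ S := (norm_nonneg _).trans (hS s hs)
  have hdiag : ∀ v ∈ P, ∀ a, φ v v a = a := fun v hv => hφ.almostFlow.diag v (hP v hv)
  have key := HA P hP (fun t u => φ t u (x u) - φ t u (y u)) ((star α * L + C) * S)
    (by positivity) ?_ ?_ s hs t ht hst
  · simp only [hdiag t ht] at key
    refine key.trans (le_of_eq (by ring))
  · intro u hu v hv t ht huv hvt
    have htT := hP t ht
    have hvT := hP v hv
    simp only [hdiag v hv]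
    have e1 := (h4.control v t hvt htT).bound (x v) (φ v u (x u)) (y v) (φ v u (y u))
    have e2 := hC u v t huv hvt htT (x u) (y u)
    have hhat : (hat t v (max ‖x v - φ v u (x u)‖₊ ‖y v - φ v u (y u)‖₊) : ℝ)
        ≤ star α * ϖ (ω u t) := by
      have i1 : max ‖x v - φ v u (x u)‖₊ ‖y v - φ v u (y u)‖₊ ≤ α * ϖ (ω u t) := by
        have hmon : (ϖ (ω u v) : ℝ) ≤ ϖ (ω u t) := by
          exact_mod_cast hϖ.monotone (hω.mono le_rfl huv hvt htT)
        have j1 := (hα P hP x hx u hu v hv huv).trans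
          (mul_le_mul_of_nonneg_left hmon α.coe_nonneg)
        have j2 := (hα P hP y hy u hu v hv huv).trans
          (mul_le_mul_of_nonneg_left hmon α.coe_nonneg)
        exact max_le (by exact_mod_cast j1) (by exact_mod_cast j2)
      exact_mod_cast ((h4.control v t hvt htT).monotone i1).trans
        ((h4.mono_interval u v t t huv hvt le_rfl htT _).trans
          (hstar α u t (huv.trans hvt) htT))
    have hmax : max ‖x v - y v‖ ‖φ v u (x u) - φ v u (y u)‖ ≤ L * S := by
      refine max_le ((hS v hv).trans (le_mul_of_one_le_left hS0 hL)) ?_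
      exact (hφL u v huv hvT _ _).trans (mul_le_mul_of_nonneg_left (hS u hu) hL0)
    have hch : (check t v : ℝ) ≤ L' := by
      refine le_trans ?_ (le_max_right _ _)
      exact_mod_cast hcheck T hT le_rfl v t hvt htT
    have hrw : x v - φ v u (x u) - y v + φ v u (y u)
        = x v - y v - (φ v u (x u) - φ v u (y u)) := by abel
    rw [hrw] at e1
    have e1' := e1.trans (add_le_add (mul_le_mul hhat hmax (by positivity) (by positivity))
      (mul_le_mul_of_nonneg_right hch (norm_nonneg _)))
    have e2' := e2.trans (mul_le_mul_of_nonneg_left (hS u hu) (by positivity))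
    calc ‖φ t v (x v) - φ t v (y v) - (φ t u (x u) - φ t u (y u))‖
        = ‖(φ t v (x v) - φ t v (φ v u (x u)) - φ t v (y v) + φ t v (φ v u (y u)))
            + (flowDefect φ t v u (x u) - flowDefect φ t v u (y u))‖ := by
          simp only [flowDefect]; congr 1; abel
      _ ≤ _ := norm_add_le _ _
      _ ≤ _ := add_le_add e1' e2'
      _ = _ := by ring
  · intro s t hst
    simp only [hdiag t hst.2.1]
    rw [hx s t hst, hy s t hst]

/-- Schemes depend on their initial value in a Lipschitz way, uniformly in the set of times. -/
theorem IsStableAlmostFlow.exists_scheme_lipschitz (hT : 0 < T) (hω : IsControl T ω)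
    (hϖ : IsRemainder ϖ) (hφ : IsStableAlmostFlow T ω ϖ δ η φ) {L : ℝ} (hL : 1 ≤ L)
    (hφL : ∀ s t, s ≤ t → t ≤ T → ∀ a b, ‖φ t s a - φ t s b‖ ≤ L * ‖a - b‖) :
    ∃ K : ℝ≥0, ∀ P : Finset ℝ≥0, (∀ u ∈ P, u ≤ T) → ∀ x y, IsScheme φ P x → IsScheme φ P y →
      ∀ s ∈ P, ∀ t ∈ P, s ≤ t → ‖x t - y t‖ ≤ K * ‖x s - y s‖ := by
  have hL0 : 0 ≤ L := zero_le_one.trans hL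
  obtain ⟨B, hB, HB⟩ := hφ.exists_scheme_sub_bound hT hω hϖ hL hφL
  obtain ⟨x₀, hx₀, Hx₀⟩ := hϖ.exists_le_mul one_pos
  -- below the threshold `c`, half of the supremum can be absorbed
  obtain ⟨b, hb⟩ : ∃ b : ℝ≥0, (b : ℝ) = 1 / (2 * (B + 1)) := ⟨⟨_, by positivity⟩, rfl⟩
  have hb0 : 0 < b := by
    rw [← NNReal.coe_pos, hb]; positivity
  set c : ℝ≥0 := min x₀ b with hc
  have hc0 : 0 < c := lt_min hx₀ hb0
  have hBc : B * c ≤ 1 / 2 := by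
    have h1 : (c : ℝ) ≤ 1 / (2 * (B + 1)) := by
      rw [← hb]
      exact_mod_cast min_le_right x₀ b
    calc B * c ≤ (B + 1) * (1 / (2 * (B + 1))) := by gcongr; linarith
      _ = 1 / 2 := by field_simp
  have hsmall : ∀ P : Finset ℝ≥0, (∀ u ∈ P, u ≤ T) → ∀ x y, IsScheme φ P x → IsScheme φ P y →
      ∀ s ∈ P, ∀ t ∈ P, s ≤ t → ω s t ≤ c → ‖x t - y t‖ ≤ 2 * L * ‖x s - y s‖ := by
    intro P hP x y hx hy s hs t ht hst hωc
    set Q := P.filter fun u => s ≤ u ∧ u ≤ t with hQ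
    have hsQ : s ∈ Q := Finset.mem_filter.2 ⟨hs, le_rfl, hst⟩
    have htQ : t ∈ Q := Finset.mem_filter.2 ⟨ht, hst, le_rfl⟩
    obtain ⟨m, hm, hmax⟩ := Q.exists_max_image (fun u => ‖x u - y u‖) ⟨s, hsQ⟩
    have hm' := Finset.mem_filter.1 hm
    have h1 := HB Q (fun u hu => hP u (Finset.mem_filter.1 hu).1) x y (hx.filter s t)
      (hy.filter s t) _ hmax s hsQ m hm hm'.2.1
    have h2 : (ϖ (ω s m) : ℝ) ≤ c := by
      have i1 : ω s m ≤ c := (hω.mono le_rfl hm'.2.1 hm'.2.2 (hP t ht)).trans hωc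
      have i2 := Hx₀ (ω s m) (i1.trans (min_le_left _ _))
      rw [one_mul] at i2
      exact i2.trans (by exact_mod_cast i1)
    have h3 := hφL s m hm'.2.1 (hP m hm'.1) (x s) (y s)
    have h4 : ‖x m - y m‖ ≤ 1 / 2 * ‖x m - y m‖ + L * ‖x s - y s‖ :=
      calc ‖x m - y m‖
          = ‖((x m - y m) - (φ m s (x s) - φ m s (y s))) + (φ m s (x s) - φ m s (y s))‖ := by
            rw [sub_add_cancel]
        _ ≤ _ := norm_add_le _ _
        _ ≤ B * ‖x m - y m‖ * c + L * ‖x s - y s‖ := by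
          refine add_le_add (h1.trans ?_) h3
          gcongr
        _ = B * c * ‖x m - y m‖ + L * ‖x s - y s‖ := by ring
        _ ≤ _ := by gcongr
    have h5 := hmax t htQ
    linarith
  -- each doubling of the admissible size of `ω` costs two applications of the previous bound and
  -- one single step
  have hK : ∀ k : ℕ, ∃ K : ℝ, 0 ≤ K ∧ ∀ P : Finset ℝ≥0, (∀ u ∈ P, u ≤ T) → ∀ x y,
      IsScheme φ P x → IsScheme φ P y → ∀ s ∈ P, ∀ t ∈ P, s ≤ t → ω s t ≤ 2 ^ k * c →
      ‖x t - y t‖ ≤ K * ‖x s - y s‖ := by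
    intro k
    induction k with
    | zero =>
      refine ⟨2 * L, by positivity, fun P hP x y hx hy s hs t ht hst hωc => ?_⟩
      exact hsmall P hP x y hx hy s hs t ht hst (by simpa using hωc)
    | succ k ih =>
      obtain ⟨K, hK0, hK⟩ := ih
      refine ⟨max 1 (K * (L * K)), by positivity, fun P hP x y hx hy s hs t ht hst hωc => ?_⟩
      rcases hst.eq_or_lt with rfl | hlt
      · exact le_mul_of_one_le_left (norm_nonneg _) (le_max_left _ _)
      obtain ⟨p, q, hpq, hsp, hqt, hωp, hωq⟩ := hω.exists_halving hP hs ht hlt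
      have hhalf : ω s t / 2 ≤ 2 ^ k * c := by
        rw [div_le_iff₀ two_pos]
        refine hωc.trans (le_of_eq (by ring))
      have h1 := hK P hP x y hx hy s hs p hpq.1 hsp (hωp.trans hhalf)
      have h2 := hK P hP x y hx hy q hpq.2.1 t ht hqt (hωq.trans hhalf)
      have h3 := hφL p q hpq.2.2.1.le (hP q hpq.2.1) (x p) (y p)
      rw [← hx p q hpq, ← hy p q hpq] at h3
      calc ‖x t - y t‖ ≤ K * (L * (K * ‖x s - y s‖)) := by
            refine h2.trans ?_
            gcongr
            refine h3.trans ?_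
            gcongr
        _ = K * (L * K) * ‖x s - y s‖ := by ring
        _ ≤ _ := by gcongr; exact le_max_right _ _
  obtain ⟨k, hk⟩ := pow_unbounded_of_one_lt (ω 0 T / c) (one_lt_two (α := ℝ≥0))
  rw [div_lt_iff₀ hc0] at hk
  obtain ⟨K, hK0, HK⟩ := hK k
  lift K to ℝ≥0 using hK0
  exact ⟨K, fun P hP x y hx hy s hs t ht hst => HK P hP x y hx hy s hs t ht hst
    ((hω.mono zero_le hst (hP t ht) le_rfl).trans hk.le)⟩

/-- A path which follows `φ` up to `ε ω` on each step of `P` stays close to the scheme with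
the same initial value. -/
theorem norm_scheme_sub_le (hω : IsControl T ω) {K : ℝ≥0}
    (hK : ∀ Q : Finset ℝ≥0, (∀ u ∈ Q, u ≤ T) → ∀ x y, IsScheme φ Q x → IsScheme φ Q y →
      ∀ s ∈ Q, ∀ t ∈ Q, s ≤ t → ‖x t - y t‖ ≤ K * ‖x s - y s‖)
    {y : ℝ≥0 → V} {ε : ℝ} {t : ℝ≥0} (P : Finset ℝ≥0) :
    (∀ u ∈ P, u ≤ T) → (∀ p q, ConsecutiveIn P p q → ‖y q - φ q p (y p)‖ ≤ ε * ω p q) → 0 ≤ ε →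
      t ∈ P → ∀ (x : ℝ≥0 → V) (s : ℝ≥0), IsScheme φ P x → s ∈ P → s ≤ t → x s = y s →
      ‖x t - y t‖ ≤ K * ε * ω s t := by
  induction P using Finset.strongInduction with
  | H P ih =>
    intro hP hy hε ht x s hx hs hst hxy
    rcases hst.eq_or_lt with rfl | hlt
    · rw [hxy, sub_self, norm_zero]; positivity
    obtain ⟨q, hsq, hqt⟩ := exists_consecutiveIn hs ht hlt
    set Q := P.filter fun u => q ≤ u ∧ u ≤ t with hQ
    have hsub : ∀ u ∈ Q, u ∈ P := fun u hu => (Finset.mem_filter.1 hu).1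
    have hqQ : q ∈ Q := Finset.mem_filter.2 ⟨hsq.2.1, le_rfl, hqt⟩
    have htQ : t ∈ Q := Finset.mem_filter.2 ⟨ht, hqt, le_rfl⟩
    have hQP : Q ⊂ P := (Finset.ssubset_iff_of_subset hsub).2
      ⟨s, hs, fun h => absurd (Finset.mem_filter.1 h).2.1 (not_le.2 hsq.2.2.1)⟩
    -- restart the scheme from the path `y` at the second point `q`
    obtain ⟨z, hz, hzq⟩ := exists_isScheme φ q (y q) Q fun u hu => (Finset.mem_filter.1 hu).2.1
    have h1 := hK Q (fun u hu => hP u (hsub u hu)) x z (hx.filter q t) hz q hqQ t htQ hqt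
    have h2 := ih Q hQP (fun u hu => hP u (hsub u hu)) (fun p q h => hy p q h.of_filter) hε htQ z q
      hz hqQ hqt hzq
    have h3 := hy s q hsq
    rw [norm_sub_rev, ← hxy, ← hx s q hsq, ← hzq] at h3
    have h4 : (ω s q + ω q t : ℝ) ≤ ω s t := by
      exact_mod_cast hω.superadditive s q t hsq.2.2.1.le hqt (hP t ht)
    calc ‖x t - y t‖ ≤ ‖x t - z t‖ + ‖z t - y t‖ := norm_sub_le_norm_sub_add_norm_sub _ _ _
      _ ≤ K * (ε * ω s q) + K * ε * ω q t := by
        refine add_le_add (h1.trans ?_) h2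
        gcongr
      _ = K * ε * (ω s q + ω q t) := by ring
      _ ≤ K * ε * ω s t := by gcongr

end Schemes

/-! ### Solutions as limits of schemes -/

/-- The initial time `r` and the times of `P` which lie in `[r,T]`. -/
noncomputable def timesFrom (T r : ℝ≥0) (P : Finset ℝ≥0) : Finset ℝ≥0 :=
  (insert r P).filter fun u => r ≤ u ∧ u ≤ T

theorem mem_timesFrom {T r u : ℝ≥0} {P : Finset ℝ≥0} :
    u ∈ timesFrom T r P ↔ (u = r ∨ u ∈ P) ∧ r ≤ u ∧ u ≤ T := by
  rw [timesFrom, Finset.mem_filter, Finset.mem_insert]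

theorem timesFrom_mono {T r : ℝ≥0} {P Q : Finset ℝ≥0} (h : P ⊆ Q) :
    timesFrom T r P ⊆ timesFrom T r Q := fun u hu => by
  rw [mem_timesFrom] at hu ⊢
  exact ⟨hu.1.imp_right fun hu' => h hu', hu.2⟩

theorem IsControl.exists_fine {T : ℝ≥0} {ω : ℝ≥0 → ℝ≥0 → ℝ≥0} {ϖ : ℝ≥0 → ℝ≥0}
    (hω : IsControl T ω) (hϖ : IsRemainder ϖ) {ε : ℝ} (hε : 0 < ε) :
    ∃ G : Finset ℝ≥0, ∀ P, G ⊆ P → ∀ r p q, ConsecutiveIn (timesFrom T r P) p q →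
      (ϖ (ω p q) : ℝ) ≤ ε * ω p q := by
  obtain ⟨x₀, hx₀, H⟩ := hϖ.exists_le_mul hε
  obtain ⟨G, hG⟩ := hω.exists_grid hx₀
  refine ⟨G, fun P hP r p q ⟨hp, hq, hpq, hc⟩ => H _ (hG p q hpq.le (mem_timesFrom.1 hq).2.2 ?_)⟩
  intro g hg
  rcases lt_or_ge g r with h | h
  · exact Or.inl (h.le.trans (mem_timesFrom.1 hp).2.1)
  rcases lt_or_ge T g with h' | h'
  · exact Or.inr ((mem_timesFrom.1 hq).2.2.trans h'.le)
  · exact hc g (mem_timesFrom.2 ⟨Or.inr (hP hg), h, h'⟩)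

section Limit

variable {V : Type*} [NormedAddCommGroup V] {T : ℝ≥0} {ω : ℝ≥0 → ℝ≥0 → ℝ≥0} {ϖ δ η : ℝ≥0 → ℝ≥0}
  {φ : ℝ≥0 → ℝ≥0 → V → V}

/-- Consistency and stability give convergence: a path whose one-step errors are of the order of
the remainder is uniformly close to the schemes along fine sets of times. -/
theorem exists_scheme_close (hω : IsControl T ω) (hϖ : IsRemainder ϖ) {K : ℝ≥0}
    (hK : ∀ Q : Finset ℝ≥0, (∀ u ∈ Q, u ≤ T) → ∀ x y, IsScheme φ Q x → IsScheme φ Q y →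
      ∀ s ∈ Q, ∀ t ∈ Q, s ≤ t → ‖x t - y t‖ ≤ K * ‖x s - y s‖) (c : ℝ≥0) {ε : ℝ} (hε : 0 < ε) :
    ∃ G : Finset ℝ≥0, ∀ P, G ⊆ P → ∀ r ≤ T, ∀ x y : ℝ≥0 → V, IsScheme φ (timesFrom T r P) x →
      (∀ s ∈ timesFrom T r P, ∀ t ∈ timesFrom T r P, s ≤ t →
        ‖y t - φ t s (y s)‖ ≤ c * ϖ (ω s t)) →
      x r = y r → ∀ t ∈ timesFrom T r P, ‖x t - y t‖ ≤ ε := by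
  set ε' : ℝ := ε / (K * c * ω 0 T + 1) with hε'
  have hden : (0 : ℝ) < K * c * ω 0 T + 1 := by positivity
  have hε'0 : 0 < ε' := div_pos hε hden
  obtain ⟨G, hG⟩ := hω.exists_fine hϖ hε'0
  refine ⟨G, fun P hP r hr x y hx hy hxy t ht => ?_⟩
  have ht' := mem_timesFrom.1 ht
  have h1 := norm_scheme_sub_le hω hK (y := y) (ε := c * ε') (timesFrom T r P)
    (fun u hu => (mem_timesFrom.1 hu).2.2)
    (fun p q h => (hy p h.1 q h.2.1 h.2.2.1.le).trans (by
      rw [mul_assoc]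
      exact mul_le_mul_of_nonneg_left (hG P hP r p q h) c.coe_nonneg))
    (by positivity) ht x r hx (mem_timesFrom.2 ⟨Or.inl rfl, le_rfl, hr⟩) ht'.2.1 hxy
  have h2 : (ω r t : ℝ) ≤ ω 0 T := by
    exact_mod_cast hω.mono zero_le ht'.2.1 ht'.2.2 le_rfl
  calc ‖x t - y t‖ ≤ K * (c * ε') * ω r t := h1
    _ ≤ K * (c * ε') * ω 0 T := by gcongr
    _ ≤ (K * c * ω 0 T + 1) * ε' := by linarith
    _ = ε := by rw [hε']; field_simp

open Filter in
/-- Schemes along finite sets of times, directed by inclusion, converge. The limit solves the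
equation, is the only solution with this initial value, and depends on it in a Lipschitz way. -/
theorem IsStableAlmostFlow.exists_solutions [CompleteSpace V] (hT : 0 < T) (hω : IsControl T ω)
    (hϖ : IsRemainder ϖ) (hη : Monotone η) (hφ : IsStableAlmostFlow T ω ϖ δ η φ) :
    ∃ (Y : ℝ≥0 → V → ℝ≥0 → V) (α K : ℝ≥0), ∀ r ≤ T, ∀ a : V, Y r a r = a ∧
      (∀ s t, r ≤ s → s ≤ t → t ≤ T → ‖Y r a t - φ t s (Y r a s)‖ ≤ α * ϖ (ω s t)) ∧
      (∀ (z : ℝ≥0 → V) (c : ℝ≥0), z r = a →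
        (∀ s t, r ≤ s → s ≤ t → t ≤ T → ‖z t - φ t s (z s)‖ ≤ c * ϖ (ω s t)) →
        ∀ t, r ≤ t → t ≤ T → z t = Y r a t) ∧
      ∀ b t, r ≤ t → t ≤ T → ‖Y r a t - Y r b t‖ ≤ K * ‖a - b‖ := by
  obtain ⟨L, hL, hφL⟩ := hφ.almostFlow.exists_lipschitz hT hω hη
  obtain ⟨α, hα⟩ := hφ.almostFlow.exists_scheme_bound hω hϖ (zero_le_one.trans hL) hφL
  obtain ⟨K, hK⟩ := hφ.exists_scheme_lipschitz hT hω hϖ hL hφL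
  choose X hX hXr using fun (P : Finset ℝ≥0) (r : ℝ≥0) (a : V) =>
    exists_isScheme φ r a (timesFrom T r P) fun u hu => (mem_timesFrom.1 hu).2.1
  have hle : ∀ P r, ∀ u ∈ timesFrom T r P, u ≤ T := fun P r u hu => (mem_timesFrom.1 hu).2.2
  have hr_mem : ∀ P, ∀ r ≤ T, r ∈ timesFrom T r P := fun P r hr =>
    mem_timesFrom.2 ⟨Or.inl rfl, le_rfl, hr⟩
  have hmem : ∀ r t, r ≤ t → t ≤ T → ∀ᶠ P in atTop, t ∈ timesFrom T r P := fun r t hrt ht =>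
    (eventually_ge_atTop ({t} : Finset ℝ≥0)).mono fun P hP =>
      mem_timesFrom.2 ⟨Or.inr (hP (Finset.mem_singleton_self t)), hrt, ht⟩
  have hlim : ∀ r a t, ∃ l : V, r ≤ t → t ≤ T → Tendsto (fun P => X P r a t) atTop (𝓝 l) := by
    intro r a t
    by_cases htr : r ≤ t ∧ t ≤ T
    swap
    · exact ⟨0, fun h h' => absurd ⟨h, h'⟩ htr⟩
    obtain ⟨hrt, ht⟩ := htr
    have hcauchy : CauchySeq fun P => X P r a t := by
      refine Metric.cauchySeq_iff'.2 fun ε hε => ?_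
      obtain ⟨G, hG⟩ := exists_scheme_close hω hϖ hK α (half_pos hε)
      refine ⟨insert t G, fun P hP => ?_⟩
      rw [dist_comm, dist_eq_norm]
      -- the finer scheme, sampled on the coarser set of times, is a path with small one-step errors
      refine (hG (insert t G) (Finset.subset_insert t G) r (hrt.trans ht) (X _ r a) (X P r a)
        (hX _ r a) (fun s hs u hu hsu => ?_) ((hXr _ r a).trans (hXr P r a).symm) t
        (mem_timesFrom.2 ⟨Or.inr (Finset.mem_insert_self t G), hrt, ht⟩)).trans_lt (half_lt_self hε)
      exact hα _ (hle P r) _ (hX P r a) s (timesFrom_mono hP hs) u (timesFrom_mono hP hu) hsu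
    obtain ⟨l, hl⟩ := cauchySeq_tendsto_of_complete hcauchy
    exact ⟨l, fun _ _ => hl⟩
  choose Y hY using hlim
  refine ⟨Y, α, K, fun r hr a => ⟨?_, ?_, ?_, ?_⟩⟩
  · refine tendsto_nhds_unique (hY r a r le_rfl hr) ?_
    simp only [hXr]
    exact tendsto_const_nhds
  · intro s t hrs hst ht
    have h1 := hY r a t (hrs.trans hst) ht
    have h2 := ((hφ.almostFlow.continuous s t hst ht).tendsto _).comp (hY r a s hrs (hst.trans ht))
    refine le_of_tendsto (h1.sub h2).norm ?_
    filter_upwards [hmem r s hrs (hst.trans ht), hmem r t (hrs.trans hst) ht] with P hs' ht'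
    exact hα _ (hle P r) _ (hX P r a) s hs' t ht' hst
  · intro z c hzr hz t hrt ht
    refine tendsto_nhds_unique ?_ (hY r a t hrt ht)
    refine Metric.tendsto_nhds.2 fun ε hε => ?_
    obtain ⟨G, hG⟩ := exists_scheme_close hω hϖ hK c (half_pos hε)
    filter_upwards [eventually_ge_atTop G, hmem r t hrt ht] with P hP htP
    rw [dist_eq_norm]
    refine (hG P hP r hr _ z (hX P r a) (fun s hs u hu hsu => ?_) ((hXr P r a).trans hzr.symm) t
      htP).trans_lt (half_lt_self hε)
    exact hz s u (mem_timesFrom.1 hs).2.1 hsu (mem_timesFrom.1 hu).2.2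
  · intro b t hrt ht
    refine le_of_tendsto ((hY r a t hrt ht).sub (hY r b t hrt ht)).norm ?_
    filter_upwards [hmem r t hrt ht] with P htP
    have := hK _ (hle P r) _ _ (hX P r a) (hX P r b) r (hr_mem P r hr) t htP hrt
    rwa [hXr, hXr] at this

/-- A solution inherits the continuity in time of the almost flow. -/
theorem continuous_of_isTimeContinuous (hω : IsControl T ω) (hϖ : IsRemainder ϖ)
    (hφ : IsTimeContinuous T φ) {r : ℝ≥0} {y : Set.Icc r T → V} {c : ℝ≥0}
    (hy : ∀ s t : Set.Icc r T, s ≤ t → ‖y t - φ t s (y s)‖ ≤ c * ϖ (ω s t)) : Continuous y := by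
  -- a modulus of continuity, to be symmetrised
  have key : ∀ ε : ℝ, 0 < ε → ∃ h : ℝ≥0, 0 < h ∧ ∀ s t : Set.Icc r T, s ≤ t →
      (t : ℝ≥0) ≤ s + h → ‖y t - y s‖ < ε := by
    intro ε hε
    obtain ⟨h₁, hh₁, H₁⟩ := hφ (ε / 3) (by positivity)
    obtain ⟨x₀, hx₀, Hx₀⟩ := hϖ.exists_le_mul one_pos
    obtain ⟨e, he⟩ : ∃ e : ℝ≥0, (e : ℝ) = ε / (3 * (c + 1)) := ⟨⟨_, by positivity⟩, rfl⟩
    have he0 : 0 < e := by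
      rw [← NNReal.coe_pos, he]; positivity
    obtain ⟨h₂, hh₂, H₂⟩ := hω.exists_small (lt_min hx₀ he0)
    refine ⟨min h₁ h₂, lt_min hh₁ hh₂, fun s t hst hth => ?_⟩
    have hst' : (s : ℝ≥0) ≤ t := hst
    have i1 := H₁ s t hst' t.2.2 (hth.trans (add_le_add_right (min_le_left _ _) _)) (y s)
    have i2 := H₂ s t hst' t.2.2 (hth.trans (add_le_add_right (min_le_right _ _) _))
    have i3 : (ϖ (ω s t) : ℝ) ≤ ε / (3 * (c + 1)) := by
      have j1 := Hx₀ _ (i2.trans (min_le_left _ _))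
      rw [one_mul] at j1
      rw [← he]
      exact j1.trans (by exact_mod_cast i2.trans (min_le_right _ _))
    have i4 : (c : ℝ) * ϖ (ω s t) ≤ ε / 3 :=
      calc (c : ℝ) * ϖ (ω s t) ≤ (c + 1) * (ε / (3 * (c + 1))) := by gcongr; linarith
        _ = ε / 3 := by field_simp
    calc ‖y t - y s‖ ≤ ‖y t - φ t s (y s)‖ + ‖φ t s (y s) - y s‖ :=
          norm_sub_le_norm_sub_add_norm_sub _ _ _
      _ ≤ ε / 3 + ε / 3 := add_le_add ((hy s t hst).trans i4) i1
      _ < ε := by linarith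
  refine Metric.continuous_iff.2 fun b ε hε => ?_
  obtain ⟨h, hh, H⟩ := key ε hε
  refine ⟨h, by exact_mod_cast hh, fun a hab => ?_⟩
  rw [Subtype.dist_eq, NNReal.dist_eq, abs_lt] at hab
  rw [dist_eq_norm]
  rcases le_total a b with hle | hle
  · rw [norm_sub_rev]
    refine H a b hle ?_
    rw [← NNReal.coe_le_coe]
    push_cast
    linarith
  · refine H b a hle ?_
    rw [← NNReal.coe_le_coe]
    push_cast
    linarith

end Limit

theorem mainTheorem4 {V : Type*} [NormedAddCommGroup V] [NormedSpace ℝ V] [CompleteSpace V]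
    (T : ℝ≥0) (hT : 0 < T)
    (ω : ℝ≥0 → ℝ≥0 → ℝ≥0) (hω : IsControl T ω)
    (ϖ : ℝ≥0 → ℝ≥0) (hϖ : IsRemainder ϖ)
    (δ : ℝ≥0 → ℝ≥0) (hδ : IsHorizonModulus δ)
    (η : ℝ≥0 → ℝ≥0) (hη : IsHolderGauge T ω ϖ δ 1 η)
    (φ : ℝ≥0 → ℝ≥0 → V → V) (hφ : IsStableAlmostFlow T ω ϖ δ η φ) :
    ∃ y : (r : Set.Icc 0 T) → V → Set.Icc (r : ℝ≥0) T → V,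
      IsManifoldOfSolutions T ω ϖ φ y ∧
      (∀ z : (r : Set.Icc 0 T) → V → Set.Icc (r : ℝ≥0) T → V,
        IsManifoldOfSolutions T ω ϖ φ z → z = y) ∧
      IsSupLipschitz T y ∧
      (IsTimeContinuous T φ → IsLipschitzIntoContinuous T y) := by
  obtain ⟨Y, α, K, H⟩ := hφ.exists_solutions hT hω hϖ hη.monotone
  have hsol : ∀ (r : Set.Icc 0 T) (a : V) (s t : Set.Icc (r : ℝ≥0) T), s ≤ t →
      ‖Y r a t - φ t s (Y r a s)‖ ≤ α * ϖ (ω s t) := fun r a s t hst =>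
    (H r r.2.2 a).2.1 s t s.2.1 hst t.2.2
  have hlip : ∀ (r : Set.Icc 0 T) (a b : V) (t : Set.Icc (r : ℝ≥0) T),
      ‖Y r a t - Y r b t‖ ≤ K * ‖a - b‖ := fun r a b t =>
    (H r r.2.2 a).2.2.2 b t t.2.1 t.2.2
  refine ⟨fun r a t => Y r a t, fun r a => ⟨(H r r.2.2 a).1, α, hsol r a⟩, fun z hz => ?_,
    ⟨K, hlip⟩, fun hc => ⟨K, fun r => ?_⟩⟩
  · funext r a t
    obtain ⟨hz0, c, hzc⟩ := hz r a
    -- the path `z r a`, extended by `0` outside `[r,T]`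
    let z' : ℝ≥0 → V := fun u => if h : (r : ℝ≥0) ≤ u ∧ u ≤ T then z r a ⟨u, h⟩ else 0
    have hz' : ∀ u (h : (r : ℝ≥0) ≤ u ∧ u ≤ T), z' u = z r a ⟨u, h⟩ := fun u h => dif_pos h
    have := (H r r.2.2 a).2.2.1 z' c ((hz' r ⟨le_rfl, r.2.2⟩).trans hz0)
      (fun s u hs hsu hu => by
        rw [hz' u ⟨hs.trans hsu, hu⟩, hz' s ⟨hs, hsu.trans hu⟩]
        exact hzc ⟨s, hs, hsu.trans hu⟩ ⟨u, hs.trans hsu, hu⟩ hsu) t t.2.1 t.2.2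
    rwa [hz' t t.2] at this
  · refine ⟨fun a => ⟨fun t => Y r a t, continuous_of_isTimeContinuous hω hϖ hc (hsol r a)⟩,
      fun a t => rfl, LipschitzWith.of_dist_le_mul fun a b => ?_⟩
    rw [ContinuousMap.dist_le (by positivity)]
    intro t
    rw [dist_eq_norm, dist_eq_norm]
    exact hlip r a b t
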